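/- Let $x_1,\dots,x_n\in\mathbb R^d$ be a normalized data set, i.e. $\frac1n\sum_{i=1}^n x_i=0$ and $\frac1{dn}\sum_{i=1}^n\|x_i\|^2=1$, and let $q=\frac1n\sum_{i=1}^n\delta_{x_i}$. Let $a,m:[0,1]\to[0,\infty)$ be continuous on $[0,1]$ and smooth on $(0,1)$, with $a_0=0=m_1$ and $a_1=1=m_0$. Put $$p_t(x\mid y)=\mathcal N(x\mid a_t y,\,m_t^2 I),\qquad p_t(x)=\int p_t(x\mid y)\,q(dy),$$ $$u_t(x\mid y)=\frac{\dot m_t}{m_t}\,x+\Bigl(\dot a_t-a_t\frac{\dot m_t}{m_t}\Bigr)y,\qquad u_t(x)=\int u_t(x\mid y)\,\frac{p_t(x\mid y)}{p_t(x)}\,q(dy),$$ and define the kinetic energy and the conditional kinetic energy by $$\mathcal E=\frac1d\int_0^1\!\!\int_{\mathbb R^d}\|u_t(x)\|^2\,p_t(x)\,dx\,dt,\qquad \mathcal E_c=\frac1d\int_0^1\!\!\int\!\!\int_{\mathbb R^d}\|u_t(x\mid y)\|^2\,p_t(x\mid y)\,dx\,q(dy)\,dt .$$ Let $M\in\mathbb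 R$, and assume that (i) $t\mapsto a_t/m_t$ is strictly increasing (with value $\infty$ at $t=1$), and (ii) $\|a\|_{1,\infty}\le M$ and $\|m\|_{1,\infty}\le M$, where $\|f\|_{1,\infty}=\max\{\sup_{t\in[0,1]}|f(t)|,\ \sup_{t\in(0,1)}|\dot f(t)|\}$. Then $\mathcal E$ and $\mathcal E_c$ are finite, and $$\mathcal E_c-6M^2\frac{n}{\sqrt d}\ \le\ \mathcal E\ \le\ \mathcal E_c .$$ -/

import Mathlib

open MeasureTheory
open scoped ContDiff

namespace KineticPath

/-- The data space: `ℝ^d` with the Euclidean norm. -/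
abbrev Space (d : ℕ) : Type := EuclideanSpace ℝ (Fin d)

/-- The density at `x` of the isotropic Gaussian `N(μ, σ² I)` on `ℝ^d`, for `σ > 0`. -/
noncomputable def gaussianDensity {d : ℕ} (μ : Space d) (σ : ℝ) (x : Space d) : ℝ :=
  (2 * Real.pi * σ ^ 2) ^ (-((d : ℝ) / 2)) * Real.exp (-(‖x - μ‖ ^ 2 / (2 * σ ^ 2)))

/-- The uniform distribution on the `n` data points `x 0, …, x (n - 1)`,
each index carrying the mass `1 / n`. -/
noncomputable def empirical {d n : ℕ} (x : Fin n → Space d) : Measure (Space d) :=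
  (n : ENNReal)⁻¹ • ∑ i, Measure.dirac (x i)

/-- The data set is normalized: it has mean zero and average variance one. -/
structure IsNormalized {d n : ℕ} (x : Fin n → Space d) : Prop where
  mean : (1 / (n : ℝ)) • ∑ i, x i = 0
  var : (1 / ((d : ℝ) * (n : ℝ))) * ∑ i, ‖x i‖ ^ 2 = 1

/-- The class of admissible coefficient pairs `(a_t, m_t)` of affine conditionals. Only the values
on `[0, 1]` matter. -/
structure IsAffineConditional (a m : ℝ → ℝ) : Prop where
  a_nonneg : ∀ t ∈ Set.Icc (0 : ℝ) 1, 0 ≤ a t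
  m_nonneg : ∀ t ∈ Set.Icc (0 : ℝ) 1, 0 ≤ m t
  a_zero : a 0 = 0
  a_one : a 1 = 1
  m_zero : m 0 = 1
  m_one : m 1 = 0
  a_cont : ContinuousOn a (Set.Icc 0 1)
  m_cont : ContinuousOn m (Set.Icc 0 1)
  a_smooth : ContDiffOn ℝ ∞ a (Set.Ioo 0 1)
  m_smooth : ContDiffOn ℝ ∞ m (Set.Ioo 0 1)

/-- The `W^{1,∞}([0,1])` norm of a function that is continuous on `[0, 1]` and smooth
on `(0, 1)`, as an extended nonnegative number. For such a function the derivative is only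
guaranteed to exist on `(0, 1)`, and its supremum there is its essential supremum. -/
noncomputable def sobolevNorm (f : ℝ → ℝ) : ENNReal :=
  max (⨆ t ∈ Set.Icc (0 : ℝ) 1, ‖f t‖ₑ) (⨆ t ∈ Set.Ioo (0 : ℝ) 1, ‖deriv f t‖ₑ)

/-- The conditional density `p_t(x | x₁)` of `N(a_t x₁, m_t² I)`. -/
noncomputable def condDensity {d : ℕ} (a m : ℝ → ℝ) (t : ℝ) (x x₁ : Space d) : ℝ :=
  gaussianDensity (a t • x₁) (m t) x

/-- The marginal density `p_t(x) = ∫ p_t(x | x₁) q(dx₁)`. -/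
noncomputable def margDensity {d : ℕ} (q : Measure (Space d)) (a m : ℝ → ℝ) (t : ℝ)
    (x : Space d) : ℝ :=
  ∫ x₁, condDensity a m t x x₁ ∂q

/-- The conditional vector field `u_t(x | x₁) = α_t x + β_t x₁` with `α_t = m_t' / m_t` and
`β_t = a_t' - a_t m_t' / m_t`. -/
noncomputable def condField {d : ℕ} (a m : ℝ → ℝ) (t : ℝ) (x x₁ : Space d) : Space d :=
  (deriv m t / m t) • x + (deriv a t - a t * (deriv m t / m t)) • x₁

/-- The marginal vector field `u_t(x) = ∫ u_t(x | x₁) p_t(x | x₁) / p_t(x) q(dx₁)`. -/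
noncomputable def margField {d : ℕ} (q : Measure (Space d)) (a m : ℝ → ℝ) (t : ℝ)
    (x : Space d) : Space d :=
  ∫ x₁, (condDensity a m t x x₁ / margDensity q a m t x) • condField a m t x x₁ ∂q

/-- The kinetic energy `(1/d) E_{t, p_t(x)} ‖u_t(x)‖²` with `t` uniform on the unit interval, as an
extended nonnegative number. (The endpoints, where the Gaussian may degenerate, are null.) -/
noncomputable def kineticEnergy {d : ℕ} (q : Measure (Space d)) (a m : ℝ → ℝ) : ENNReal :=
  (d : ENNReal)⁻¹ * ∫⁻ t in Set.Ioo (0 : ℝ) 1, ∫⁻ x : Space d,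
    ENNReal.ofReal (margDensity q a m t x) * ‖margField q a m t x‖ₑ ^ 2

/-- The conditional kinetic energy `(1/d) E_{t, q(x₁), p_t(x | x₁)} ‖u_t(x | x₁)‖²`, as an extended
nonnegative number. -/
noncomputable def condKineticEnergy {d : ℕ} (q : Measure (Space d)) (a m : ℝ → ℝ) : ENNReal :=
  (d : ENNReal)⁻¹ * ∫⁻ t in Set.Ioo (0 : ℝ) 1, ∫⁻ x₁, ∫⁻ x : Space d,
    ENNReal.ofReal (condDensity a m t x x₁) * ‖condField a m t x x₁‖ₑ ^ 2 ∂volume ∂q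

end KineticPath

/-!
Why the kinetic energy of the mixture is close to its conditional counterpart.

At a fixed time the conditional energy exceeds the marginal one by an expected posterior variance:
`u_t(x)` is the posterior mean of `u_t(x | x₁)`, so the law of total variance
(`sum_mul_norm_sq_eq`) gives `E ≤ E_c` at once and expresses the gap through the pairwise
differences `u_t(x | x_i) - u_t(x | x_j) = β (x_i - x_j)`, where `β = m r'` and `r = a / m`. The
pair `i ≠ j` enters with the weight `p_i p_j / ∑ p_k ≤ √(p_i p_j) / 2`, and the geometric mean of
two Gaussians of variance `m²` centered at `a x_i` and `a x_j` is `exp (-r² D² / 8)` times a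
Gaussian density, with `D = ‖x_i - x_j‖` (`gaussianDensity_mul_gaussianDensity`). Hence the gap at
time `t` is at most `∑ β² D² exp (-r² D² / 8) / (4 n)` over all pairs
(`condEnergy_le_margEnergy_add`).

In time, `β² = (a' m - a m') r' ≤ 2 M² r'` (`IsAffineConditional.coeff_sq_le`), and since `r` is
increasing the substitution `r = a / m` turns the time integral into a Gaussian integral over
`(0, ∞)`: `∫ r' D² exp (-r² D² / 8) dt ≤ 3 D` (`IsAffineConditional.lintegral_ratioDeriv_le`).
Finally the normalization bounds the sum of all distances `D` by `2 n² √d`, which yields a gap of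
at most `3 M² n / √d`.

The energies are extended nonnegative integrals, so the comparison is carried out there; the
finiteness of `E_c` comes from a second-moment bound that is uniform in time
(`lintegral_condDensity_mul_condField_le`).
-/

namespace KineticPath

/-! ### Isotropic Gaussian densities -/

section Gaussian

variable {d : ℕ}

lemma gaussianDensity_pos (μ : Space d) {σ : ℝ} (hσ : 0 < σ) (x : Space d) :
    0 < gaussianDensity μ σ x := by
  unfold gaussianDensity
  positivity

lemma continuous_gaussianDensity (μ : Space d) (σ : ℝ) : Continuous (gaussianDensity μ σ) := by
  unfold gaussianDensity
  fun_prop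

lemma integral_gaussianDensity (μ : Space d) {σ : ℝ} (hσ : 0 < σ) :
    ∫ x, gaussianDensity μ σ x = 1 := by
  have hb : 0 < (2 * σ ^ 2)⁻¹ := by positivity
  have h := GaussianFourier.integral_rexp_neg_mul_sq_norm (V := Space d) hb
  have hs := integral_sub_right_eq_self (μ := (volume : Measure (Space d)))
    (fun v : Space d => Real.exp (-(2 * σ ^ 2)⁻¹ * ‖v‖ ^ 2)) μ
  have he : ∀ x : Space d, gaussianDensity μ σ x = (2 * Real.pi * σ ^ 2) ^ (-((d : ℝ) / 2)) *
      Real.exp (-(2 * σ ^ 2)⁻¹ * ‖x - μ‖ ^ 2) := by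
    intro x
    unfold gaussianDensity
    congr 2
    ring
  simp_rw [he]
  rw [integral_const_mul, hs, h, finrank_euclideanSpace_fin]
  have hpi : Real.pi / (2 * σ ^ 2)⁻¹ = 2 * Real.pi * σ ^ 2 := by
    rw [div_inv_eq_mul]
    ring
  rw [hpi, ← Real.rpow_add (by positivity)]
  simp

lemma lintegral_gaussianDensity (μ : Space d) {σ : ℝ} (hσ : 0 < σ) :
    ∫⁻ x, ENNReal.ofReal (gaussianDensity μ σ x) = 1 := by
  have h := integral_gaussianDensity μ hσ
  rw [← ofReal_integral_eq_lintegral_ofReal (integrable_of_integral_eq_one h)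
    (.of_forall fun x => (gaussianDensity_pos μ hσ x).le), h, ENNReal.ofReal_one]

/-- A crude bound on the second moment of a Gaussian: `s ≤ exp s` trades the factor `‖x - μ‖²`
for a doubling of the variance. -/
lemma lintegral_gaussianDensity_mul_sq_le (μ : Space d) {σ : ℝ} (hσ : 0 < σ) :
    ∫⁻ x, ENNReal.ofReal (gaussianDensity μ σ x * ‖x - μ‖ ^ 2) ≤
      ENNReal.ofReal (4 * σ ^ 2 * 2 ^ ((d : ℝ) / 2)) := by
  have h2 : 0 < √2 * σ := by positivity
  have hsq : (√2 * σ) ^ 2 = 2 * σ ^ 2 := by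
    rw [mul_pow, Real.sq_sqrt (by norm_num)]
  calc ∫⁻ x, ENNReal.ofReal (gaussianDensity μ σ x * ‖x - μ‖ ^ 2)
      ≤ ∫⁻ x, ENNReal.ofReal (4 * σ ^ 2 * 2 ^ ((d : ℝ) / 2)) *
          ENNReal.ofReal (gaussianDensity μ (√2 * σ) x) := by
        refine lintegral_mono fun x => ?_
        rw [← ENNReal.ofReal_mul (by positivity)]
        refine ENNReal.ofReal_le_ofReal ?_
        unfold gaussianDensity
        rw [hsq]
        have hc : (2 * Real.pi * (2 * σ ^ 2)) ^ (-((d : ℝ) / 2)) =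
            (2 ^ ((d : ℝ) / 2))⁻¹ * (2 * Real.pi * σ ^ 2) ^ (-((d : ℝ) / 2)) := by
          rw [← Real.rpow_neg (by norm_num), ← Real.mul_rpow (by norm_num) (by positivity)]
          congr 1
          ring
        set s := ‖x - μ‖ ^ 2 / (4 * σ ^ 2) with hs
        have hs1 : ‖x - μ‖ ^ 2 / (2 * σ ^ 2) = s + s := by
          rw [hs]
          field_simp
          ring
        have hs2 : ‖x - μ‖ ^ 2 / (2 * (2 * σ ^ 2)) = s := by
          rw [hs]
          congr 1
          ring
        have hs3 : ‖x - μ‖ ^ 2 = 4 * σ ^ 2 * s := by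
          rw [hs]
          field_simp
        have hs4 : Real.exp (-(s + s)) * s ≤ Real.exp (-s) := by
          have h1 : s ≤ Real.exp s := by linarith [Real.add_one_le_exp s]
          calc Real.exp (-(s + s)) * s ≤ Real.exp (-(s + s)) * Real.exp s := by gcongr
            _ = Real.exp (-s) := by
              rw [← Real.exp_add]
              congr 1
              ring
        rw [hc, hs1, hs2, hs3]
        have hp : (0 : ℝ) < 2 ^ ((d : ℝ) / 2) := by positivity
        calc _ = 4 * σ ^ 2 * (2 * Real.pi * σ ^ 2) ^ (-((d : ℝ) / 2)) *
              (Real.exp (-(s + s)) * s) := by ring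
          _ ≤ 4 * σ ^ 2 * (2 * Real.pi * σ ^ 2) ^ (-((d : ℝ) / 2)) * Real.exp (-s) := by gcongr
          _ = _ := by field_simp
    _ = _ := by
        rw [lintegral_const_mul _ (continuous_gaussianDensity _ _).measurable.ennreal_ofReal,
          lintegral_gaussianDensity _ h2, mul_one]

/-- The geometric mean of two Gaussians of equal variance is a multiple of the Gaussian centered
at the midpoint. -/
lemma gaussianDensity_mul_gaussianDensity (μ ν : Space d) (σ : ℝ) (x : Space d) :
    gaussianDensity μ σ x * gaussianDensity ν σ x =
      (Real.exp (-(‖μ - ν‖ ^ 2 / (8 * σ ^ 2))) *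
        gaussianDensity ((1 / 2 : ℝ) • (μ + ν)) σ x) ^ 2 := by
  have hn : ‖x - μ‖ ^ 2 + ‖x - ν‖ ^ 2 =
      2 * ‖x - (1 / 2 : ℝ) • (μ + ν)‖ ^ 2 + ‖μ - ν‖ ^ 2 / 2 := by
    have h := parallelogram_law_with_norm ℝ (x - μ) (x - ν)
    have h1 : x - μ + (x - ν) = (2 : ℝ) • (x - (1 / 2 : ℝ) • (μ + ν)) := by
      module
    have h2 : x - μ - (x - ν) = -(μ - ν) := by abel
    rw [h1, h2, norm_neg, norm_smul] at h
    norm_num at h ⊢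
    nlinarith
  unfold gaussianDensity
  set c := (2 * Real.pi * σ ^ 2) ^ (-((d : ℝ) / 2))
  calc _ = c ^ 2 * (Real.exp (-(‖x - μ‖ ^ 2 / (2 * σ ^ 2))) *
        Real.exp (-(‖x - ν‖ ^ 2 / (2 * σ ^ 2)))) := by ring
    _ = c ^ 2 * ((Real.exp (-(‖μ - ν‖ ^ 2 / (8 * σ ^ 2)))) ^ 2 *
        (Real.exp (-(‖x - (1 / 2 : ℝ) • (μ + ν)‖ ^ 2 / (2 * σ ^ 2)))) ^ 2) := by
      rw [← Real.exp_add, ← Real.exp_nat_mul, ← Real.exp_nat_mul, ← Real.exp_add]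
      congr 2
      have : ‖x - ν‖ ^ 2 = 2 * ‖x - (1 / 2 : ℝ) • (μ + ν)‖ ^ 2 + ‖μ - ν‖ ^ 2 / 2 -
        ‖x - μ‖ ^ 2 := by linarith
      rw [this]
      push_cast
      ring
    _ = _ := by ring

end Gaussian

/-! ### Variance decomposition of a finite mixture -/

section Mixture

variable {ι E : Type*} [Fintype ι] [NormedAddCommGroup E] [InnerProductSpace ℝ E]

/-- The law of total variance, with the variance written as a sum over pairs. -/
lemma sum_mul_norm_sq_eq (w : ι → ℝ) (hw : ∑ i, w i = 1) (u : ι → E) :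
    ∑ i, w i * ‖u i‖ ^ 2 = ‖∑ i, w i • u i‖ ^ 2 +
      ∑ i, ∑ j, w i * w j / 2 * ‖u i - u j‖ ^ 2 := by
  have h1 : ‖∑ i, w i • u i‖ ^ 2 = ∑ i, ∑ j, w i * w j * inner ℝ (u i) (u j) := by
    rw [← real_inner_self_eq_norm_sq, sum_inner]
    refine Finset.sum_congr rfl fun i _ => ?_
    rw [inner_sum]
    refine Finset.sum_congr rfl fun j _ => ?_
    rw [real_inner_smul_left, real_inner_smul_right, mul_assoc]
  have h2 : ∑ i, ∑ j, w i * w j / 2 * ‖u i - u j‖ ^ 2 =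
      ∑ i, ∑ j, w i * w j / 2 * ‖u i‖ ^ 2 - ∑ i, ∑ j, w i * w j * inner ℝ (u i) (u j) +
        ∑ i, ∑ j, w i * w j / 2 * ‖u j‖ ^ 2 := by
    simp_rw [← Finset.sum_sub_distrib, ← Finset.sum_add_distrib, norm_sub_sq_real]
    refine Finset.sum_congr rfl fun i _ => Finset.sum_congr rfl fun j _ => ?_
    ring
  have h3 : ∑ i, ∑ j, w i * w j / 2 * ‖u i‖ ^ 2 = (∑ i, w i * ‖u i‖ ^ 2) / 2 := by
    rw [Finset.sum_div]
    refine Finset.sum_congr rfl fun i _ => ?_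
    calc _ = (∑ j, w j) * (w i * ‖u i‖ ^ 2 / 2) := by
          rw [Finset.sum_mul]
          refine Finset.sum_congr rfl fun j _ => ?_
          ring
      _ = _ := by rw [hw, one_mul]
  have h4 : ∑ i, ∑ j, w i * w j / 2 * ‖u j‖ ^ 2 = (∑ i, w i * ‖u i‖ ^ 2) / 2 := by
    rw [Finset.sum_comm, ← h3]
    refine Finset.sum_congr rfl fun i _ => Finset.sum_congr rfl fun j _ => ?_
    ring
  rw [h1, h2, h3, h4]
  ring

/-- The law of total variance for unnormalized weights. -/
lemma sum_mul_norm_sq_eq_of_sum_ne_zero (p : ι → ℝ) (hp : ∑ i, p i ≠ 0) (u : ι → E) :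
    ∑ i, p i * ‖u i‖ ^ 2 = (∑ i, p i) * ‖∑ i, (p i / ∑ k, p k) • u i‖ ^ 2 +
      ∑ i, ∑ j, p i * p j / (∑ k, p k) / 2 * ‖u i - u j‖ ^ 2 := by
  have h := sum_mul_norm_sq_eq (fun i => p i / ∑ k, p k)
    (by rw [← Finset.sum_div, div_self hp]) u
  calc ∑ i, p i * ‖u i‖ ^ 2 = (∑ k, p k) * ∑ i, p i / (∑ k, p k) * ‖u i‖ ^ 2 := by
        rw [Finset.mul_sum]
        refine Finset.sum_congr rfl fun i _ => ?_
        field_simp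
    _ = _ := by
        rw [h, mul_add, Finset.mul_sum]
        congr 1
        refine Finset.sum_congr rfl fun i _ => ?_
        rw [Finset.mul_sum]
        refine Finset.sum_congr rfl fun j _ => ?_
        field_simp

/-- Averaging over the posterior can only decrease the energy. -/
lemma sum_mul_norm_sq_avg_le (p : ι → ℝ) (hp : ∀ i, 0 ≤ p i) (hs : ∑ i, p i ≠ 0) (u : ι → E) :
    (∑ i, p i) * ‖∑ i, (p i / ∑ k, p k) • u i‖ ^ 2 ≤ ∑ i, p i * ‖u i‖ ^ 2 := by
  rw [sum_mul_norm_sq_eq_of_sum_ne_zero p hs u]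
  have hS : 0 ≤ ∑ i, p i := Finset.sum_nonneg fun i _ => hp i
  refine le_add_of_nonneg_right (Finset.sum_nonneg fun i _ => Finset.sum_nonneg fun j _ => ?_)
  have := hp i
  have := hp j
  positivity

/-- The energy lost by averaging over the posterior is controlled by the pairwise geometric means
of the weights: for `i ≠ j` the total weight is at least `p i + p j ≥ 2 √(p i p j)`. -/
lemma sum_mul_norm_sq_le_add (p : ι → ℝ) (hp : ∀ i, 0 < p i) (hs : ∑ i, p i ≠ 0) (u : ι → E)
    (h : ι → ι → ℝ) (h0 : ∀ i j, 0 ≤ h i j) (hh : ∀ i j, p i * p j = h i j ^ 2) :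
    ∑ i, p i * ‖u i‖ ^ 2 ≤ (∑ i, p i) * ‖∑ i, (p i / ∑ k, p k) • u i‖ ^ 2 +
      ∑ i, ∑ j, h i j / 4 * ‖u i - u j‖ ^ 2 := by
  classical
  rw [sum_mul_norm_sq_eq_of_sum_ne_zero p hs u]
  refine add_le_add le_rfl (Finset.sum_le_sum fun i _ => Finset.sum_le_sum fun j _ => ?_)
  rcases eq_or_ne i j with rfl | hij
  · simp
  have hS : p i + p j ≤ ∑ k, p k := by
    rw [← Finset.sum_pair hij]
    exact Finset.sum_le_sum_of_subset_of_nonneg (Finset.subset_univ _) fun k _ _ => (hp k).le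
  have hij0 := hh i j
  have := h0 i j
  have := hp i
  have := hp j
  refine mul_le_mul_of_nonneg_right ?_ (sq_nonneg _)
  have h2 : 2 * h i j ≤ p i + p j := by
    nlinarith [sq_nonneg (p i - p j)]
  rw [div_div, div_le_div_iff₀ (by linarith) (by norm_num), hij0]
  nlinarith [mul_nonneg (h0 i j) (sub_nonneg.2 (h2.trans hS))]

end Mixture

/-! ### The coefficients `a`, `m` and the signal-to-noise ratio `a / m` -/

section Coefficients

lemma one_le_of_sobolevNorm_le {m : ℝ → ℝ} {M : ℝ} (h0 : m 0 = 1)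
    (hm : sobolevNorm m ≤ ENNReal.ofReal M) : 1 ≤ M := by
  have h1 : ‖m 0‖ₑ ≤ ENNReal.ofReal M :=
    (le_iSup₂ (f := fun t (_ : t ∈ Set.Icc (0 : ℝ) 1) => ‖m t‖ₑ) 0 (by simp)).trans
      ((le_max_left _ _).trans hm)
  rw [h0, enorm_one] at h1
  exact ENNReal.one_le_ofReal.1 h1

lemma abs_le_of_sobolevNorm_le {f : ℝ → ℝ} {M : ℝ} (hM : 0 ≤ M)
    (hf : sobolevNorm f ≤ ENNReal.ofReal M) {t : ℝ} (ht : t ∈ Set.Icc (0 : ℝ) 1) :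
    |f t| ≤ M := by
  have h1 : ‖f t‖ₑ ≤ ENNReal.ofReal M :=
    (le_iSup₂ (f := fun t (_ : t ∈ Set.Icc (0 : ℝ) 1) => ‖f t‖ₑ) t ht).trans
      ((le_max_left _ _).trans hf)
  rwa [Real.enorm_eq_ofReal_abs, ENNReal.ofReal_le_ofReal_iff hM] at h1

lemma abs_deriv_le_of_sobolevNorm_le {f : ℝ → ℝ} {M : ℝ} (hM : 0 ≤ M)
    (hf : sobolevNorm f ≤ ENNReal.ofReal M) {t : ℝ} (ht : t ∈ Set.Ioo (0 : ℝ) 1) :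
    |deriv f t| ≤ M := by
  have h1 : ‖deriv f t‖ₑ ≤ ENNReal.ofReal M :=
    (le_iSup₂ (f := fun t (_ : t ∈ Set.Ioo (0 : ℝ) 1) => ‖deriv f t‖ₑ) t ht).trans
      ((le_max_right _ _).trans hf)
  rwa [Real.enorm_eq_ofReal_abs, ENNReal.ofReal_le_ofReal_iff hM] at h1

variable {a m : ℝ → ℝ}

/-- Strict monotonicity of `a / m` rules out a zero of `m` inside the interval: there the
quotient would be `0` by convention, which is already its value at time `0`. -/
lemma IsAffineConditional.m_pos (ham : IsAffineConditional a m)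
    (hmono : StrictMonoOn (fun t => a t / m t) (Set.Ico (0 : ℝ) 1)) {t : ℝ}
    (ht : t ∈ Set.Ioo (0 : ℝ) 1) : 0 < m t := by
  have h := hmono (by simp) (Set.Ioo_subset_Ico_self ht) ht.1
  simp only [ham.a_zero, zero_div] at h
  refine lt_of_le_of_ne (ham.m_nonneg t (Set.Ioo_subset_Icc_self ht)) fun h0 => ?_
  rw [← h0, div_zero] at h
  exact lt_irrefl _ h

lemma IsAffineConditional.hasDerivAt_a (ham : IsAffineConditional a m) {t : ℝ}
    (ht : t ∈ Set.Ioo (0 : ℝ) 1) : HasDerivAt a (deriv a t) t :=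
  ((ham.a_smooth.differentiableOn (by simp)).differentiableAt (Ioo_mem_nhds ht.1 ht.2)).hasDerivAt

lemma IsAffineConditional.hasDerivAt_m (ham : IsAffineConditional a m) {t : ℝ}
    (ht : t ∈ Set.Ioo (0 : ℝ) 1) : HasDerivAt m (deriv m t) t :=
  ((ham.m_smooth.differentiableOn (by simp)).differentiableAt (Ioo_mem_nhds ht.1 ht.2)).hasDerivAt

/-- The derivative of the ratio `a / m`, by the quotient rule. -/
noncomputable def ratioDeriv (a m : ℝ → ℝ) (t : ℝ) : ℝ :=
  (deriv a t * m t - a t * deriv m t) / m t ^ 2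

lemma IsAffineConditional.hasDerivAt_ratio (ham : IsAffineConditional a m)
    (hmono : StrictMonoOn (fun t => a t / m t) (Set.Ico (0 : ℝ) 1)) {t : ℝ}
    (ht : t ∈ Set.Ioo (0 : ℝ) 1) :
    HasDerivAt (fun t => a t / m t) (ratioDeriv a m t) t :=
  (ham.hasDerivAt_a ht).div (ham.hasDerivAt_m ht) (ham.m_pos hmono ht).ne'

lemma IsAffineConditional.ratioDeriv_nonneg (ham : IsAffineConditional a m)
    (hmono : StrictMonoOn (fun t => a t / m t) (Set.Ico (0 : ℝ) 1)) {t : ℝ}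
    (ht : t ∈ Set.Ioo (0 : ℝ) 1) : 0 ≤ ratioDeriv a m t := by
  have h := (hmono.monotoneOn.mono Set.Ioo_subset_Ico_self).derivWithin_nonneg (x := t)
  rwa [(ham.hasDerivAt_ratio hmono ht).hasDerivWithinAt.derivWithin
    (isOpen_Ioo.uniqueDiffWithinAt ht)] at h

/-- The coefficient of `x₁` in the conditional field is `m (a / m)'`, so its square is
`m² (a / m)' · (a / m)'`, and `m² (a / m)' = a' m - a m'` is bounded. -/
lemma IsAffineConditional.coeff_sq_le (ham : IsAffineConditional a m)
    (hmono : StrictMonoOn (fun t => a t / m t) (Set.Ico (0 : ℝ) 1)) {M : ℝ} (hM : 0 ≤ M)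
    (ha : sobolevNorm a ≤ ENNReal.ofReal M) (hm : sobolevNorm m ≤ ENNReal.ofReal M) {t : ℝ}
    (ht : t ∈ Set.Ioo (0 : ℝ) 1) :
    (deriv a t - a t * (deriv m t / m t)) ^ 2 ≤ 2 * M ^ 2 * ratioDeriv a m t := by
  have hpos := ham.m_pos hmono ht
  have h1 : (deriv a t - a t * (deriv m t / m t)) ^ 2 =
      (deriv a t * m t - a t * deriv m t) * ratioDeriv a m t := by
    unfold ratioDeriv
    field_simp
  rw [h1]
  refine mul_le_mul_of_nonneg_right ?_ (ham.ratioDeriv_nonneg hmono ht)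
  have htI := Set.Ioo_subset_Icc_self ht
  calc deriv a t * m t - a t * deriv m t ≤ |deriv a t| * |m t| + |a t| * |deriv m t| := by
        rw [← abs_mul, ← abs_mul]
        linarith [le_abs_self (deriv a t * m t), neg_abs_le (a t * deriv m t)]
    _ ≤ M * M + M * M := by
        gcongr
        · exact abs_deriv_le_of_sobolevNorm_le hM ha ht
        · exact abs_le_of_sobolevNorm_le hM hm htI
        · exact abs_le_of_sobolevNorm_le hM ha htI
        · exact abs_deriv_le_of_sobolevNorm_le hM hm ht
    _ = 2 * M ^ 2 := by ring

lemma lintegral_Ioi_sq_mul_exp_le {D : ℝ} (hD : 0 ≤ D) :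
    ∫⁻ r in Set.Ioi (0 : ℝ), ENNReal.ofReal (D ^ 2 * Real.exp (-(r ^ 2 * D ^ 2 / 8))) ≤
      ENNReal.ofReal (3 * D) := by
  rcases hD.eq_or_lt with rfl | hD
  · simp
  have hb : 0 < D ^ 2 / 8 := by positivity
  have he : ∀ r : ℝ, Real.exp (-(r ^ 2 * D ^ 2 / 8)) = Real.exp (-(D ^ 2 / 8) * r ^ 2) := by
    intro r
    congr 1
    ring
  simp_rw [he]
  rw [← ofReal_integral_eq_lintegral_ofReal
    ((integrable_exp_neg_mul_sq hb).integrableOn.const_mul _) (.of_forall fun r => by positivity),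
    integral_const_mul, integral_gaussian_Ioi]
  refine ENNReal.ofReal_le_ofReal ?_
  have hs : √(Real.pi / (D ^ 2 / 8)) ≤ 6 / D := by
    refine Real.sqrt_le_iff.2 ⟨by positivity, ?_⟩
    rw [div_pow, div_div_eq_mul_div]
    gcongr
    linarith [Real.pi_lt_four]
  calc D ^ 2 * (√(Real.pi / (D ^ 2 / 8)) / 2) ≤ D ^ 2 * (6 / D / 2) := by gcongr
    _ = 3 * D := by
      field_simp
      norm_num

/-- Change of variables to the signal-to-noise ratio `r = a / m`. -/
lemma IsAffineConditional.lintegral_ratioDeriv_le (ham : IsAffineConditional a m)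
    (hmono : StrictMonoOn (fun t => a t / m t) (Set.Ico (0 : ℝ) 1)) {D : ℝ} (hD : 0 ≤ D) :
    ∫⁻ t in Set.Ioo (0 : ℝ) 1, ENNReal.ofReal (ratioDeriv a m t) *
        ENNReal.ofReal (D ^ 2 * Real.exp (-((a t / m t) ^ 2 * D ^ 2 / 8))) ≤
      ENNReal.ofReal (3 * D) := by
  rw [← lintegral_image_eq_lintegral_deriv_mul_of_monotoneOn (f := fun t => a t / m t)
    measurableSet_Ioo (fun t ht => (ham.hasDerivAt_ratio hmono ht).hasDerivWithinAt)
    (hmono.monotoneOn.mono Set.Ioo_subset_Ico_self)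
    (fun r => ENNReal.ofReal (D ^ 2 * Real.exp (-(r ^ 2 * D ^ 2 / 8))))]
  refine (lintegral_mono_set ?_).trans (lintegral_Ioi_sq_mul_exp_le hD)
  rintro _ ⟨t, ht, rfl⟩
  have h := hmono (by simp) (Set.Ioo_subset_Ico_self ht) ht.1
  simpa [ham.a_zero] using h

lemma IsAffineConditional.aemeasurable_ratio (ham : IsAffineConditional a m) :
    AEMeasurable (fun t => a t / m t) (volume.restrict (Set.Ioo (0 : ℝ) 1)) :=
  ((ham.a_cont.mono Set.Ioo_subset_Icc_self).aemeasurable measurableSet_Ioo).div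
    ((ham.m_cont.mono Set.Ioo_subset_Icc_self).aemeasurable measurableSet_Ioo)

lemma IsAffineConditional.aemeasurable_ratioDeriv (ham : IsAffineConditional a m) :
    AEMeasurable (ratioDeriv a m) (volume.restrict (Set.Ioo (0 : ℝ) 1)) := by
  have h1 := (ham.a_cont.mono Set.Ioo_subset_Icc_self).aemeasurable (μ := volume) measurableSet_Ioo
  have h2 := (ham.m_cont.mono Set.Ioo_subset_Icc_self).aemeasurable (μ := volume) measurableSet_Ioo
  exact (((measurable_deriv a).aemeasurable.mul h2).sub
    (h1.mul (measurable_deriv m).aemeasurable)).div (h2.pow_const 2)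

end Coefficients

/-! ### The energies at a fixed time -/

section FixedTime

variable {d n : ℕ}

lemma lintegral_empirical (x : Fin n → Space d) (f : Space d → ENNReal) :
    ∫⁻ y, f y ∂empirical x = (n : ENNReal)⁻¹ * ∑ i, f (x i) := by
  simp [empirical, lintegral_smul_measure, lintegral_finsetSum_measure]

lemma integral_empirical {E : Type*} [NormedAddCommGroup E] [NormedSpace ℝ E] [CompleteSpace E]
    (x : Fin n → Space d) (f : Space d → E) :
    ∫ y, f y ∂empirical x = (n : ℝ)⁻¹ • ∑ i, f (x i) := by
  rw [empirical, integral_smul_measure,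
    integral_finsetSum_measure fun i _ => integrable_dirac enorm_lt_top]
  simp

variable {a m : ℝ → ℝ} {t : ℝ}

lemma condDensity_pos (hm : 0 < m t) (y z : Space d) : 0 < condDensity a m t y z :=
  gaussianDensity_pos _ hm _

lemma continuous_condDensity (z : Space d) : Continuous fun y => condDensity a m t y z :=
  continuous_gaussianDensity _ _

lemma continuous_condField (z : Space d) : Continuous fun y => condField a m t y z := by
  unfold condField
  fun_prop

lemma condField_sub (y z z' : Space d) :
    condField a m t y z - condField a m t y z' =
      (deriv a t - a t * (deriv m t / m t)) • (z - z') := by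
  unfold condField
  module

lemma sum_condDensity_pos (hn : n ≠ 0) (hm : 0 < m t) (x : Fin n → Space d) (y : Space d) :
    0 < ∑ i, condDensity a m t y (x i) := by
  have : NeZero n := ⟨hn⟩
  exact Finset.sum_pos (fun i _ => condDensity_pos hm _ _) Finset.univ_nonempty

lemma margDensity_empirical (x : Fin n → Space d) (y : Space d) :
    margDensity (empirical x) a m t y = (n : ℝ)⁻¹ * ∑ i, condDensity a m t y (x i) := by
  rw [margDensity, integral_empirical, smul_eq_mul]

/-- For the empirical distribution the marginal field is the posterior average of the
conditional fields. -/
lemma margField_empirical (hn : n ≠ 0) (hm : 0 < m t) (x : Fin n → Space d) (y : Space d) :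
    margField (empirical x) a m t y =
      ∑ i, (condDensity a m t y (x i) / ∑ k, condDensity a m t y (x k)) •
        condField a m t y (x i) := by
  have hS := (sum_condDensity_pos (a := a) hn hm x y).ne'
  rw [margField, integral_empirical, Finset.smul_sum, margDensity_empirical]
  refine Finset.sum_congr rfl fun i _ => ?_
  rw [smul_smul]
  congr 1
  field_simp

lemma ofReal_mul_enorm_sq {E : Type*} [NormedAddCommGroup E] {c : ℝ} (hc : 0 ≤ c) (v : E) :
    ENNReal.ofReal c * ‖v‖ₑ ^ 2 = ENNReal.ofReal (c * ‖v‖ ^ 2) := by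
  rw [ENNReal.ofReal_mul hc, ENNReal.ofReal_pow (norm_nonneg _), ofReal_norm]

lemma margEnergy_integrand (hn : n ≠ 0) (hm : 0 < m t) (x : Fin n → Space d) (y : Space d) :
    ENNReal.ofReal (margDensity (empirical x) a m t y) *
        ‖margField (empirical x) a m t y‖ₑ ^ 2 =
      ENNReal.ofReal ((n : ℝ)⁻¹ * ((∑ i, condDensity a m t y (x i)) *
        ‖∑ i, (condDensity a m t y (x i) / ∑ k, condDensity a m t y (x k)) •
          condField a m t y (x i)‖ ^ 2)) := by
  have hS := sum_condDensity_pos (a := a) hn hm x y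
  rw [margField_empirical hn hm, margDensity_empirical, ofReal_mul_enorm_sq (by positivity),
    mul_assoc]

lemma condEnergy_eq_sum (hm : 0 < m t) (x : Fin n → Space d) :
    ∫⁻ z, ∫⁻ y : Space d, ENNReal.ofReal (condDensity a m t y z) * ‖condField a m t y z‖ₑ ^ 2
        ∂volume ∂empirical x =
      (n : ENNReal)⁻¹ * ∑ i, ∫⁻ y, ENNReal.ofReal
        (condDensity a m t y (x i) * ‖condField a m t y (x i)‖ ^ 2) := by
  simp_rw [lintegral_empirical, ofReal_mul_enorm_sq (condDensity_pos hm _ _).le]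

lemma condEnergy_eq_lintegral (hn : n ≠ 0) (hm : 0 < m t) (x : Fin n → Space d) :
    ∫⁻ z, ∫⁻ y : Space d, ENNReal.ofReal (condDensity a m t y z) * ‖condField a m t y z‖ₑ ^ 2
        ∂volume ∂empirical x =
      ∫⁻ y, ENNReal.ofReal ((n : ℝ)⁻¹ *
        ∑ i, condDensity a m t y (x i) * ‖condField a m t y (x i)‖ ^ 2) := by
  have hmeas : ∀ i, Measurable fun y => ENNReal.ofReal
      (condDensity a m t y (x i) * ‖condField a m t y (x i)‖ ^ 2) := fun i =>
    ((continuous_condDensity _).mul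
      ((continuous_condField _).norm.pow 2)).measurable.ennreal_ofReal
  have hn' : (0 : ℝ) < n := by positivity
  rw [condEnergy_eq_sum hm, ← lintegral_finsetSum _ fun i _ => hmeas i,
    ← lintegral_const_mul _ (Finset.measurable_fun_sum _ fun i _ => hmeas i)]
  refine lintegral_congr fun y => ?_
  rw [ENNReal.ofReal_mul (by positivity), ENNReal.ofReal_inv_of_pos hn', ENNReal.ofReal_natCast,
    ENNReal.ofReal_sum_of_nonneg fun i _ => mul_nonneg (condDensity_pos hm _ _).le (sq_nonneg _)]

lemma margEnergy_le_condEnergy (hn : n ≠ 0) (hm : 0 < m t) (x : Fin n → Space d) :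
    ∫⁻ y, ENNReal.ofReal (margDensity (empirical x) a m t y) *
        ‖margField (empirical x) a m t y‖ₑ ^ 2 ≤
      ∫⁻ z, ∫⁻ y : Space d, ENNReal.ofReal (condDensity a m t y z) * ‖condField a m t y z‖ₑ ^ 2
        ∂volume ∂empirical x := by
  rw [condEnergy_eq_lintegral hn hm]
  refine lintegral_mono fun y => ?_
  rw [margEnergy_integrand hn hm]
  refine ENNReal.ofReal_le_ofReal (mul_le_mul_of_nonneg_left ?_ (by positivity))
  exact sum_mul_norm_sq_avg_le _ (fun i => (condDensity_pos hm _ _).le)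
    (sum_condDensity_pos hn hm x y).ne' _

/-- The energy gap at a fixed time. The geometric mean of two components with data points at
distance `D` has total mass `exp (-(a / m)² D² / 8)`. -/
lemma condEnergy_le_margEnergy_add (hn : n ≠ 0) (hm : 0 < m t) (x : Fin n → Space d) :
    ∫⁻ z, ∫⁻ y : Space d, ENNReal.ofReal (condDensity a m t y z) * ‖condField a m t y z‖ₑ ^ 2
        ∂volume ∂empirical x ≤
      (∫⁻ y, ENNReal.ofReal (margDensity (empirical x) a m t y) *
        ‖margField (empirical x) a m t y‖ₑ ^ 2) +
      ∑ i, ∑ j, ENNReal.ofReal ((n : ℝ)⁻¹ / 4 *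
        ((deriv a t - a t * (deriv m t / m t)) ^ 2 *
          (‖x i - x j‖ ^ 2 * Real.exp (-((a t / m t) ^ 2 * ‖x i - x j‖ ^ 2 / 8))))) := by
  set β := deriv a t - a t * (deriv m t / m t) with hβ
  set e : Fin n → Fin n → ℝ := fun i j => Real.exp (-((a t / m t) ^ 2 * ‖x i - x j‖ ^ 2 / 8))
    with he
  set g : Fin n → Fin n → Space d → ℝ := fun i j =>
    gaussianDensity ((1 / 2 : ℝ) • (a t • x i + a t • x j)) (m t) with hg
  have hg0 : ∀ i j y, 0 < g i j y := fun i j y => gaussianDensity_pos _ hm _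
  have he0 : ∀ i j, 0 < e i j := fun i j => Real.exp_pos _
  have hmid : ∀ i j y, condDensity a m t y (x i) * condDensity a m t y (x j) =
      (e i j * g i j y) ^ 2 := by
    intro i j y
    have hexp : e i j = Real.exp (-(‖a t • x i - a t • x j‖ ^ 2 / (8 * m t ^ 2))) := by
      rw [he, ← smul_sub, norm_smul, mul_pow, Real.norm_eq_abs, sq_abs]
      field_simp
    rw [hexp]
    exact gaussianDensity_mul_gaussianDensity _ _ _ _
  have hmeas : ∀ i j, Measurable fun y => ENNReal.ofReal
      ((n : ℝ)⁻¹ / 4 * (β ^ 2 * (‖x i - x j‖ ^ 2 * e i j))) * ENNReal.ofReal (g i j y) :=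
    fun i j => (continuous_gaussianDensity _ _).measurable.ennreal_ofReal.const_mul _
  have hgap : ∑ i, ∑ j, ENNReal.ofReal ((n : ℝ)⁻¹ / 4 * (β ^ 2 * (‖x i - x j‖ ^ 2 * e i j))) =
      ∫⁻ y, ∑ i, ∑ j, ENNReal.ofReal ((n : ℝ)⁻¹ / 4 * (β ^ 2 * (‖x i - x j‖ ^ 2 * e i j))) *
        ENNReal.ofReal (g i j y) := by
    rw [lintegral_finsetSum _ fun i _ => Finset.measurable_fun_sum _ fun j _ => hmeas i j]
    refine Finset.sum_congr rfl fun i _ => ?_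
    rw [lintegral_finsetSum _ fun j _ => hmeas i j]
    refine Finset.sum_congr rfl fun j _ => ?_
    rw [lintegral_const_mul _ (continuous_gaussianDensity _ _).measurable.ennreal_ofReal,
      lintegral_gaussianDensity _ hm, mul_one]
  rw [hgap, condEnergy_eq_lintegral hn hm, ← lintegral_add_right _
    (Finset.measurable_fun_sum _ fun i _ => Finset.measurable_fun_sum _ fun j _ => hmeas i j)]
  refine lintegral_mono fun y => ?_
  have hS := sum_condDensity_pos (a := a) hn hm x y
  rw [margEnergy_integrand hn hm]
  have hterm : ∀ i j, 0 ≤ (n : ℝ)⁻¹ / 4 * (β ^ 2 * (‖x i - x j‖ ^ 2 * e i j)) * g i j y := by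
    intro i j
    have := hg0 i j y
    have := he0 i j
    positivity
  have hsum : ∑ i, ∑ j, ENNReal.ofReal ((n : ℝ)⁻¹ / 4 * (β ^ 2 * (‖x i - x j‖ ^ 2 * e i j))) *
      ENNReal.ofReal (g i j y) = ENNReal.ofReal (∑ i, ∑ j,
        (n : ℝ)⁻¹ / 4 * (β ^ 2 * (‖x i - x j‖ ^ 2 * e i j)) * g i j y) := by
    rw [ENNReal.ofReal_sum_of_nonneg fun i _ => Finset.sum_nonneg fun j _ => hterm i j]
    refine Finset.sum_congr rfl fun i _ => ?_
    rw [ENNReal.ofReal_sum_of_nonneg fun j _ => hterm i j]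
    refine Finset.sum_congr rfl fun j _ => ?_
    rw [ENNReal.ofReal_mul' (hg0 i j y).le]
  rw [hsum, ← ENNReal.ofReal_add (by positivity)
    (Finset.sum_nonneg fun i _ => Finset.sum_nonneg fun j _ => hterm i j)]
  refine ENNReal.ofReal_le_ofReal ?_
  have h := sum_mul_norm_sq_le_add (fun i => condDensity a m t y (x i))
    (fun i => condDensity_pos hm _ _) hS.ne' (fun i => condField a m t y (x i))
    (fun i j => e i j * g i j y) (fun i j => (mul_pos (he0 i j) (hg0 i j y)).le)
    (fun i j => hmid i j y)
  have hpairs : ∑ i, ∑ j, (n : ℝ)⁻¹ / 4 * (β ^ 2 * (‖x i - x j‖ ^ 2 * e i j)) * g i j y =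
      (n : ℝ)⁻¹ * ∑ i, ∑ j, e i j * g i j y / 4 *
        ‖condField a m t y (x i) - condField a m t y (x j)‖ ^ 2 := by
    simp_rw [Finset.mul_sum]
    refine Finset.sum_congr rfl fun i _ => Finset.sum_congr rfl fun j _ => ?_
    rw [condField_sub, norm_smul, mul_pow, Real.norm_eq_abs, sq_abs]
    ring
  rw [hpairs, ← mul_add]
  exact mul_le_mul_of_nonneg_left h (by positivity)

/-- A bound on the conditional energy of one data point that is uniform in time. In terms of the
standardized noise `(y - a z) / m` the field is `a' z + m' (y - a z) / m`. -/
lemma lintegral_condDensity_mul_condField_le (hm : 0 < m t) {M : ℝ} (ha' : |deriv a t| ≤ M)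
    (hm' : |deriv m t| ≤ M) (z : Space d) :
    ∫⁻ y, ENNReal.ofReal (condDensity a m t y z * ‖condField a m t y z‖ ^ 2) ≤
      ENNReal.ofReal (8 * M ^ 2 * 2 ^ ((d : ℝ) / 2)) + ENNReal.ofReal (2 * M ^ 2 * ‖z‖ ^ 2) := by
  have ha2 : deriv a t ^ 2 ≤ M ^ 2 := sq_le_sq.2 (ha'.trans (le_abs_self M))
  have hm2 : deriv m t ^ 2 ≤ M ^ 2 := sq_le_sq.2 (hm'.trans (le_abs_self M))
  have hg := (continuous_gaussianDensity (a t • z) (m t))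
  calc ∫⁻ y, ENNReal.ofReal (condDensity a m t y z * ‖condField a m t y z‖ ^ 2)
      ≤ ∫⁻ y, (ENNReal.ofReal (2 * (M / m t) ^ 2) *
            ENNReal.ofReal (gaussianDensity (a t • z) (m t) y * ‖y - a t • z‖ ^ 2) +
          ENNReal.ofReal (2 * M ^ 2 * ‖z‖ ^ 2) *
            ENNReal.ofReal (gaussianDensity (a t • z) (m t) y)) := by
        refine lintegral_mono fun y => ?_
        have hp := gaussianDensity_pos (a t • z) hm y
        rw [← ENNReal.ofReal_mul (by positivity), ← ENNReal.ofReal_mul (by positivity),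
          ← ENNReal.ofReal_add (by positivity) (by positivity)]
        refine ENNReal.ofReal_le_ofReal ?_
        have hu : condField a m t y z =
            (deriv m t / m t) • (y - a t • z) + deriv a t • z := by
          unfold condField
          module
        have h1 : ‖condField a m t y z‖ ^ 2 ≤
            2 * (M / m t) ^ 2 * ‖y - a t • z‖ ^ 2 + 2 * M ^ 2 * ‖z‖ ^ 2 := by
          rw [hu]
          have h2 := norm_add_le ((deriv m t / m t) • (y - a t • z)) (deriv a t • z)
          calc _ ≤ (‖(deriv m t / m t) • (y - a t • z)‖ + ‖deriv a t • z‖) ^ 2 := by gcongr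
            _ ≤ 2 * (‖(deriv m t / m t) • (y - a t • z)‖ ^ 2 + ‖deriv a t • z‖ ^ 2) := add_sq_le
            _ = 2 * (deriv m t ^ 2 / m t ^ 2) * ‖y - a t • z‖ ^ 2 +
                2 * deriv a t ^ 2 * ‖z‖ ^ 2 := by
              simp only [norm_smul, mul_pow, Real.norm_eq_abs, sq_abs, div_pow]
              ring
            _ ≤ _ := by
              rw [div_pow]
              gcongr
        calc condDensity a m t y z * ‖condField a m t y z‖ ^ 2
            ≤ gaussianDensity (a t • z) (m t) y *
              (2 * (M / m t) ^ 2 * ‖y - a t • z‖ ^ 2 + 2 * M ^ 2 * ‖z‖ ^ 2) :=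
              mul_le_mul_of_nonneg_left h1 hp.le
          _ = _ := by ring
    _ = ENNReal.ofReal (2 * (M / m t) ^ 2) *
            (∫⁻ y, ENNReal.ofReal (gaussianDensity (a t • z) (m t) y * ‖y - a t • z‖ ^ 2)) +
          ENNReal.ofReal (2 * M ^ 2 * ‖z‖ ^ 2) := by
        rw [lintegral_add_right _ (hg.measurable.ennreal_ofReal.const_mul _),
          lintegral_const_mul _ hg.measurable.ennreal_ofReal, lintegral_gaussianDensity _ hm,
          mul_one, lintegral_const_mul _ (by fun_prop)]
    _ ≤ ENNReal.ofReal (2 * (M / m t) ^ 2) * ENNReal.ofReal (4 * m t ^ 2 * 2 ^ ((d : ℝ) / 2)) +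
          ENNReal.ofReal (2 * M ^ 2 * ‖z‖ ^ 2) := by
        gcongr
        exact lintegral_gaussianDensity_mul_sq_le _ hm
    _ = _ := by
        rw [← ENNReal.ofReal_mul (by positivity)]
        congr 2
        field_simp
        ring

end FixedTime

/-! ### Integration over time -/

section Energies

variable {d n : ℕ} {a m : ℝ → ℝ} {M : ℝ}

/-- By Cauchy–Schwarz, a normalized data set has total pairwise distance at most `2 n² √d`. -/
lemma IsNormalized.sum_norm_sub_le {x : Fin n → Space d} (hd : d ≠ 0) (hn : n ≠ 0)
    (hx : IsNormalized x) : ∑ i, ∑ j, ‖x i - x j‖ ≤ 2 * n ^ 2 * √d := by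
  have hsq : ∑ i, ‖x i‖ ^ 2 = d * n := by
    have h := hx.var
    field_simp at h
    linarith
  have hcs : ∑ i, ‖x i‖ ≤ n * √d := by
    have h := sq_sum_le_card_mul_sum_sq (s := Finset.univ) (f := fun i => ‖x i‖)
    rw [hsq, Finset.card_univ, Fintype.card_fin] at h
    refine abs_le_of_sq_le_sq' ?_ (by positivity) |>.2
    rw [mul_pow, Real.sq_sqrt (by positivity)]
    linarith
  calc ∑ i, ∑ j, ‖x i - x j‖ ≤ ∑ i, ∑ j, (‖x i‖ + ‖x j‖) := by
        gcongr
        exact norm_sub_le _ _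
    _ = 2 * n * ∑ i, ‖x i‖ := by
        simp only [Finset.sum_add_distrib, Finset.sum_const, Finset.card_univ, Fintype.card_fin,
          nsmul_eq_mul, ← Finset.mul_sum]
        ring
    _ ≤ 2 * n * (n * √d) := by gcongr
    _ = _ := by ring

lemma kineticEnergy_le_condKineticEnergy (hn : n ≠ 0) (x : Fin n → Space d)
    (ham : IsAffineConditional a m)
    (hmono : StrictMonoOn (fun t => a t / m t) (Set.Ico (0 : ℝ) 1)) :
    kineticEnergy (empirical x) a m ≤ condKineticEnergy (empirical x) a m := by
  unfold kineticEnergy condKineticEnergy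
  gcongr 1
  exact setLIntegral_mono' measurableSet_Ioo fun t ht =>
    margEnergy_le_condEnergy hn (ham.m_pos hmono ht) x

lemma condKineticEnergy_ne_top (hd : d ≠ 0) (hn : n ≠ 0) (x : Fin n → Space d)
    (ham : IsAffineConditional a m)
    (hmono : StrictMonoOn (fun t => a t / m t) (Set.Ico (0 : ℝ) 1)) (hM : 0 ≤ M)
    (ha : sobolevNorm a ≤ ENNReal.ofReal M) (hm : sobolevNorm m ≤ ENNReal.ofReal M) :
    condKineticEnergy (empirical x) a m ≠ ⊤ := by
  unfold condKineticEnergy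
  refine ENNReal.mul_ne_top (by simpa using hd) (ne_top_of_le_ne_top ?_
    (setLIntegral_mono' (g := fun _ => (n : ENNReal)⁻¹ * ∑ i,
      (ENNReal.ofReal (8 * M ^ 2 * 2 ^ ((d : ℝ) / 2)) + ENNReal.ofReal (2 * M ^ 2 * ‖x i‖ ^ 2)))
      measurableSet_Ioo fun t ht => ?_))
  · rw [setLIntegral_const, Real.volume_Ioo]
    refine ENNReal.mul_ne_top (ENNReal.mul_ne_top (by simpa using hn) ?_) ENNReal.ofReal_ne_top
    exact ENNReal.sum_ne_top.2 fun i _ => ENNReal.add_ne_top.2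
      ⟨ENNReal.ofReal_ne_top, ENNReal.ofReal_ne_top⟩
  · rw [condEnergy_eq_sum (ham.m_pos hmono ht)]
    gcongr with i _
    exact lintegral_condDensity_mul_condField_le (ham.m_pos hmono ht)
      (abs_deriv_le_of_sobolevNorm_le hM ha ht) (abs_deriv_le_of_sobolevNorm_le hM hm ht) _

lemma condKineticEnergy_le_add (hd : d ≠ 0) (hn : n ≠ 0) {x : Fin n → Space d}
    (hx : IsNormalized x) (ham : IsAffineConditional a m)
    (hmono : StrictMonoOn (fun t => a t / m t) (Set.Ico (0 : ℝ) 1)) (hM : 0 ≤ M)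
    (ha : sobolevNorm a ≤ ENNReal.ofReal M) (hm : sobolevNorm m ≤ ENNReal.ofReal M) :
    condKineticEnergy (empirical x) a m ≤
      kineticEnergy (empirical x) a m + ENNReal.ofReal (3 * M ^ 2 * (n / √d)) := by
  set c : ℝ := (n : ℝ)⁻¹ / 4 * (2 * M ^ 2) with hc
  have hc0 : 0 ≤ c := by positivity
  set G : Fin n → Fin n → ℝ → ENNReal := fun i j t => ENNReal.ofReal c *
    (ENNReal.ofReal (ratioDeriv a m t) * ENNReal.ofReal
      (‖x i - x j‖ ^ 2 * Real.exp (-((a t / m t) ^ 2 * ‖x i - x j‖ ^ 2 / 8)))) with hG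
  have hcore : ∀ i j, AEMeasurable (fun t => ENNReal.ofReal (ratioDeriv a m t) * ENNReal.ofReal
      (‖x i - x j‖ ^ 2 * Real.exp (-((a t / m t) ^ 2 * ‖x i - x j‖ ^ 2 / 8))))
      (volume.restrict (Set.Ioo (0 : ℝ) 1)) := fun i j =>
    ham.aemeasurable_ratioDeriv.ennreal_ofReal.mul
      ((((ham.aemeasurable_ratio.pow_const 2).mul_const _).div_const 8).neg.exp.const_mul
        _).ennreal_ofReal
  have hmeas : ∀ i j, AEMeasurable (G i j) (volume.restrict (Set.Ioo (0 : ℝ) 1)) :=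
    fun i j => (hcore i j).const_mul _
  have hgap : ∫⁻ t in Set.Ioo (0 : ℝ) 1, ∑ i, ∑ j, G i j t ≤
      ENNReal.ofReal (c * 3 * (2 * n ^ 2 * √d)) := by
    rw [lintegral_finsetSum' _ fun i _ => Finset.aemeasurable_fun_sum _ fun j _ => hmeas i j]
    calc ∑ i, ∫⁻ t in Set.Ioo (0 : ℝ) 1, ∑ j, G i j t
        ≤ ∑ i, ∑ j, ENNReal.ofReal (c * 3 * ‖x i - x j‖) := by
          refine Finset.sum_le_sum fun i _ => ?_
          rw [lintegral_finsetSum' _ fun j _ => hmeas i j]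
          refine Finset.sum_le_sum fun j _ => ?_
          rw [lintegral_const_mul'' _ (hcore i j), mul_assoc c, ENNReal.ofReal_mul hc0]
          gcongr
          exact ham.lintegral_ratioDeriv_le hmono (norm_nonneg _)
      _ = ENNReal.ofReal (c * 3 * ∑ i, ∑ j, ‖x i - x j‖) := by
          simp_rw [Finset.mul_sum]
          rw [ENNReal.ofReal_sum_of_nonneg fun i _ => by positivity]
          refine Finset.sum_congr rfl fun i _ => ?_
          rw [ENNReal.ofReal_sum_of_nonneg fun j _ => by positivity]
      _ ≤ _ := by
          gcongr
          exact hx.sum_norm_sub_le hd hn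
  calc condKineticEnergy (empirical x) a m
      ≤ (d : ENNReal)⁻¹ * ∫⁻ t in Set.Ioo (0 : ℝ) 1,
          ((∫⁻ y, ENNReal.ofReal (margDensity (empirical x) a m t y) *
            ‖margField (empirical x) a m t y‖ₑ ^ 2) + ∑ i, ∑ j, G i j t) := by
        unfold condKineticEnergy
        gcongr 1
        refine setLIntegral_mono' measurableSet_Ioo fun t ht => ?_
        refine (condEnergy_le_margEnergy_add hn (ham.m_pos hmono ht) x).trans ?_
        gcongr with i _ j _
        have hr := ham.ratioDeriv_nonneg hmono ht
        simp only [hG]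
        rw [← ENNReal.ofReal_mul hr, ← ENNReal.ofReal_mul hc0]
        refine ENNReal.ofReal_le_ofReal ?_
        have h := ham.coeff_sq_le hmono hM ha hm ht
        rw [hc, mul_assoc (_ / 4), ← mul_assoc (2 * M ^ 2)]
        gcongr
    _ = kineticEnergy (empirical x) a m +
          (d : ENNReal)⁻¹ * ∫⁻ t in Set.Ioo (0 : ℝ) 1, ∑ i, ∑ j, G i j t := by
        rw [lintegral_add_right' _ (Finset.aemeasurable_fun_sum _ fun i _ =>
          Finset.aemeasurable_fun_sum _ fun j _ => hmeas i j), mul_add, kineticEnergy]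
    _ ≤ kineticEnergy (empirical x) a m +
          ENNReal.ofReal (d : ℝ)⁻¹ * ENNReal.ofReal (c * 3 * (2 * n ^ 2 * √d)) := by
        rw [ENNReal.ofReal_inv_of_pos (by positivity), ENNReal.ofReal_natCast]
        gcongr
    _ = _ := by
        rw [← ENNReal.ofReal_mul (by positivity)]
        congr 2
        have hs : √(d : ℝ) ^ 2 = d := Real.sq_sqrt (by positivity)
        have hs0 : √(d : ℝ) ≠ 0 := by positivity
        rw [hc]
        nth_rewrite 1 [← hs]
        field_simp
        norm_num

end Energies

end KineticPath

theorem theorem3 {d n : ℕ} (x : Fin n → KineticPath.Space d) (hx : KineticPath.IsNormalized x)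
    (M : ℝ) (a m : ℝ → ℝ) (ham : KineticPath.IsAffineConditional a m)
    (hmono : StrictMonoOn (fun t => a t / m t) (Set.Ico (0 : ℝ) 1))
    (ha : KineticPath.sobolevNorm a ≤ ENNReal.ofReal M)
    (hm : KineticPath.sobolevNorm m ≤ ENNReal.ofReal M) :
    KineticPath.kineticEnergy (KineticPath.empirical x) a m ≠ ⊤ ∧
    KineticPath.condKineticEnergy (KineticPath.empirical x) a m ≠ ⊤ ∧
    (KineticPath.condKineticEnergy (KineticPath.empirical x) a m).toReal
        - 6 * M ^ 2 * ((n : ℝ) / Real.sqrt (d : ℝ))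
      ≤ (KineticPath.kineticEnergy (KineticPath.empirical x) a m).toReal ∧
    (KineticPath.kineticEnergy (KineticPath.empirical x) a m).toReal
      ≤ (KineticPath.condKineticEnergy (KineticPath.empirical x) a m).toReal := by
  -- For `d = 0` or `n = 0` the variance normalization would read `0 = 1`.
  have hd : d ≠ 0 := by
    rintro rfl
    simpa using hx.var
  have hn : n ≠ 0 := by
    rintro rfl
    simpa using hx.var
  have hM : 0 ≤ M := zero_le_one.trans (KineticPath.one_le_of_sobolevNorm_le ham.m_zero hm)
  have hle := KineticPath.kineticEnergy_le_condKineticEnergy hn x ham hmono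
  have hc := KineticPath.condKineticEnergy_ne_top hd hn x ham hmono hM ha hm
  have hk := ne_top_of_le_ne_top hc hle
  refine ⟨hk, hc, ?_, ENNReal.toReal_mono hc hle⟩
  have hgap := ENNReal.toReal_mono (ENNReal.add_ne_top.2 ⟨hk, ENNReal.ofReal_ne_top⟩)
    (KineticPath.condKineticEnergy_le_add hd hn hx ham hmono hM ha hm)
  rw [ENNReal.toReal_add hk ENNReal.ofReal_ne_top, ENNReal.toReal_ofReal (by positivity)] at hgap
  have h0 : 0 ≤ M ^ 2 * ((n : ℝ) / √(d : ℝ)) := by positivity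
  linarith
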